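/- **Theorem (Counting FloodSet with perfect recall).** Consider $n$ agents with initial values in $\{0,1\}$ and the hard crash failure model $\mathit{Crash}_t$ with $t<n$: at most $t$ agents crash; an agent that crashes in a round delivers an arbitrary subset of its messages of that round, has the local state $\mathit{crashed}$ from the end of that round on, and sends nothing afterwards; all other messages are delivered. In *Counting FloodSet with perfect recall*, the local state of a nonfailed agent is $\langle W,h,m,v\rangle$, where $W$ is the set of values seen so far, $h$ is the list in which $h[k]$, for $1\le k\le m$, is the number of agents from which no message was received in round $k$, $m$ is the time, and $v$ is the agent's initial value; the initial state is $\langle\{v\},[0],0,v\rangle$. In every round each nonfailed agent sends $W$ to all agents (a nonfailed agent always receives its own message), adds all values received to $W$, and appends the number of missing messages to $h$. *Counting FloodSet* is the same, except that only the number of messages missing in the latest round is kept (initially $0$). Decisions affect neither messages nor states. A point is a pair of a run and a time; an agent knows $\varphi$ at a point if $\varphi$ holds at all points of the system at which it has the same local state; $\mathcal N$ is the set of nonfailed agents at a point; and $C_{\mathcal N}\varphi$ means $E_{\mathcal N}^k\varphi$ for all $k\ge 1$, where $E_{\mathcal N}\varphi$ says that every agent in $\mathcal N$ knows $\varphi$.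 Let $\exists v$ say that some agent has initial value $v$. Let $r$ be a run of Counting FloodSet with perfect recall, $\mathcal I$ the system of all its runs, and $m\ge 0$ a time. 1. For every agent $i$ whose local state at $(r,m)$ is $\langle W,h,m,v_i\rangle$ (i.e. that has not crashed), $$(\mathcal I,r,m)\models \bigvee_{v\in\{0,1\}} C_{\mathcal N}(\exists v)\quad\Longleftrightarrow\quad m\ge\min\{t+1,n-1\}\ \text{ or }\ h[k]\ge n-1\text{ for some }1\le k\le m .$$ 2. Perfect recall gives no earlier stopping: if $r'$ is the run of Counting FloodSet with the same initial values and the same failures as $r$, and $\mathcal I'$ is the system of all runs of Counting FloodSet, then $(\mathcal I,r,m)\models\bigvee_{v} C_{\mathcal N}(\exists v)$ if and only if $(\mathcal I',r',m)\models\bigvee_{v} C_{\mathcal N}(\exists v)$. -/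

import Mathlib

namespace FloodSBA

/-- The possible initial values `0` and `1`. -/
abbrev Value : Type := Fin 2

/-- The actions of an agent in simultaneous Byzantine agreement. -/
inductive Action : Type
  | decide (v : Value)
  | noop

/-- Adversaries of the hard crash failure model `Crash_t` for `n` agents.
`delivers k i j = true` says that the adversary lets the message of `i` to `j` through in
round `k + 1`, i.e. between time `k` and time `k + 1`; `delivers k i i = false` says that `i`
has crashed by the end of that round. -/
@[ext]
structure Adversary (n t : ℕ) where
  delivers : ℕ → Fin n → Fin n → Bool
  /-- Messages are lost only through a crash of their sender in the same round or earlier. -/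
  crash_of_lost : ∀ k i j, delivers k i j = false → delivers k i i = false
  /-- A crashed agent sends no message in later rounds. -/
  silent_of_crash : ∀ k i, delivers k i i = false → ∀ k', k < k' → ∀ j, delivers k' i j = false
  /-- At most `t` agents are faulty. -/
  faulty_le : {i : Fin n | ∃ k j, delivers k i j = false}.ncard ≤ t

/-- An information exchange protocol for `n` agents in the failure model `Crash_t`; all agents use
the same type `L` of local states and the same type `M` of messages, and `none` stands for
"no message". `start i v` is the unique initial local state of agent `i` with initial value `v`. -/
structure InfoExchange (n t : ℕ) where
  L : Type
  M : Type
  crashed : L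
  start : Fin n → Value → L
  send : Fin n → L → Action → Fin n → Option M
  update : Fin n → L → Adversary n t → Action → (Fin n → Option M) → L

variable {n t : ℕ}

/-- A global state: an environment state (the adversary) and a local state of each agent. -/
abbrev GlobalState (E : InfoExchange n t) : Type := Adversary n t × (Fin n → E.L)

/-- A run assigns a global state to each time. -/
abbrev Run (E : InfoExchange n t) : Type := ℕ → GlobalState E

/-- A decision protocol. -/
abbrev DecisionProtocol (E : InfoExchange n t) : Type := Fin n → E.L → Action

/-- The messages that agent `i` receives in the round that starts in global state `g` at time
`k`, indexed by sender. -/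
def received (E : InfoExchange n t) (P : DecisionProtocol E) (k : ℕ) (g : GlobalState E)
    (i : Fin n) : Fin n → Option E.M :=
  fun j => if g.1.delivers k j i = true then E.send j (g.2 j) (P j (g.2 j)) i else none

/-- The system of all runs of the information exchange `E` with the decision protocol `P`. -/
def system (E : InfoExchange n t) (P : DecisionProtocol E) : Set (Run E) :=
  {r | (∃ v : Fin n → Value, ∀ i, (r 0).2 i = E.start i (v i)) ∧
    ∀ k, (r (k + 1)).1 = (r k).1 ∧
      ∀ i, (r (k + 1)).2 i =
        E.update i ((r k).2 i) (r k).1 (P i ((r k).2 i)) (received E P k (r k) i)}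

/-! ### Logic of knowledge

A formula is represented by its truth value at each point `(r, m)`. -/

/-- (Truth values of) formulas. -/
abbrev Formula (E : InfoExchange n t) : Type := Run E → ℕ → Prop

/-- The set of agents that have not failed at the point `(r, m)`. -/
def nonfailed {E : InfoExchange n t} (r : Run E) (m : ℕ) : Set (Fin n) :=
  {i | (r m).2 i ≠ E.crashed}

/-- The atomic proposition "some agent has initial value `v` in the current run". -/
def someInit {E : InfoExchange n t} (v : Value) : Formula E :=
  fun r _ => ∃ i, (r 0).2 i = E.start i v

/-- Agent `i` knows `φ`, in the system `R`. -/
def Knows {E : InfoExchange n t} (R : Set (Run E)) (i : Fin n) (φ : Formula E) : Formula E :=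
  fun r m => ∀ r' ∈ R, ∀ m', (r m).2 i = (r' m').2 i → φ r' m'

/-- Every nonfailed agent knows `φ`. -/
def EveryoneKnows {E : InfoExchange n t} (R : Set (Run E)) (φ : Formula E) : Formula E :=
  fun r m => ∀ i ∈ nonfailed r m, Knows R i φ r m

/-- `φ` is common knowledge among the nonfailed agents: "everyone knows", iterated `k` times,
holds of `φ` for every `k ≥ 1`. -/
def CommonKnowledge {E : InfoExchange n t} (R : Set (Run E)) (φ : Formula E) : Formula E :=
  fun r m => ∀ k : ℕ, 1 ≤ k → ((EveryoneKnows R)^[k] φ) r m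

/-- For some value `v`, it is common knowledge that `v` is the initial value of some agent. -/
def CommonKnowledgeOfSomeValue {E : InfoExchange n t} (R : Set (Run E)) : Formula E :=
  fun r m => ∃ v : Value, CommonKnowledge R (someInit v) r m

/-- Two runs correspond if they have the same failure pattern and the same initial values. -/
def Corresponding {E E' : InfoExchange n t} (r : Run E) (r' : Run E') : Prop :=
  (r 0).1 = (r' 0).1 ∧ ∀ i v, (r 0).2 i = E.start i v ↔ (r' 0).2 i = E'.start i v

/-! ### The counting variants of FloodSet -/

/-- Local states `⟨W, h, τ, v⟩`: the set `W` of values seen so far, the record `h` of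
missing-message counts, the time `τ`, and the initial value `v`; or `crashed`. -/
inductive LocalState (H : Type) : Type
  | crashed
  | active (W : Set Value) (h : H) (τ : ℕ) (v : Value)

/-- Each nonfailed agent sends its set `W` to every agent. -/
def floodSend {H : Type} : LocalState H → Option (Set Value)
  | .crashed => none
  | .active W _ _ _ => some W

/-- The number of agents from which no message was received. (The message of a nonfailed agent to
itself is always received, so that only messages of other agents can be missing for it.) -/
noncomputable def missing (msgs : Fin n → Option (Set Value)) : ℕ :=
  {j | msgs j = none}.ncard

open Classical in
/-- State update of agent `i`: unless the agent crashes, it adds the values received to `W`, and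
updates its record `h` by `record h c`, where `c` is the number of missing messages. -/
noncomputable def floodUpdate {H : Type} (record : H → ℕ → H) (i : Fin n) (s : LocalState H)
    (F : Adversary n t) (msgs : Fin n → Option (Set Value)) : LocalState H :=
  match s with
  | .crashed => .crashed
  | .active W h τ v =>
      if F.delivers τ i i = true then
        .active (W ∪ {x | ∃ j W', msgs j = some W' ∧ x ∈ W'}) (record h (missing msgs)) (τ + 1) v
      else .crashed

/-- Counting FloodSet: only the number of messages missing in the last round is stored. -/
noncomputable def countExchange (n t : ℕ) : InfoExchange n t where
  L := LocalState ℕ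
  M := Set Value
  crashed := .crashed
  start _ v := .active {v} 0 0 v
  send _ s _ _ := floodSend s
  update i s F _ msgs := floodUpdate (fun _ c => c) i s F msgs

/-- Counting FloodSet with perfect recall: the number of messages missing in the current round is
appended to the list `h`, which is `[0]` initially, so that the entry of `h` with index `k ≥ 1`
is the number of messages missing in round `k`. -/
noncomputable def countRecallExchange (n t : ℕ) : InfoExchange n t where
  L := LocalState (List ℕ)
  M := Set Value
  crashed := .crashed
  start _ v := .active {v} [0] 0 v
  send _ s _ _ := floodSend s
  update i s F _ msgs := floodUpdate (fun h c => h ++ [c]) i s F msgs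

end FloodSBA

/-! A run is determined by its adversary and its initial values, and common knowledge passes between
points that share a nonfailed agent with the same local state, hence along the chains `Linked`.

Sufficiency: if none of `m ≥ min (t + 1) (n - 1)` rounds is free of crashes, the crashes leave at
most one survivor; otherwise a crash-free round equalizes the sets `W`. Either way the survivors
agree (`agree_of_le`), and since local states contain the time, any value they have seen is commonly
known to occur. If a survivor missed `n - 1` messages in some round, it is the only survivor, its
latest count shows this, and its own initial value is common knowledge.

Necessity: otherwise the point is linked to points with constant initial values of either kind
(`exists_linked_const`), which rules out both values. In the last round `i` heard from some `j`,
which may be assumed to survive. With two survivors whose sets `W` depend on the initial values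
alone (`Insensitive`), counts cannot prevent the crashes from being removed one by one
(`linked_failureFree`). A chain of `m` crashes that carries a value to one survivor and hides it
from another then changes the initial values (`linked_const_oneOff`).

`Similar` compares all counts, while sufficiency reads only the last one. The same condition
therefore characterizes both exchanges, which gives the second claim. -/

namespace FloodSBA

variable {n t : ℕ}

/-! ### Local states as functions of the adversary and the initial values -/

namespace Adversary

/-- Agent `i` has not crashed by time `m`. -/
def Alive (F : Adversary n t) (m : ℕ) (i : Fin n) : Prop :=
  ∀ k < m, F.delivers k i i = true

/-- The set of values that `i` has seen by time `m`, provided that it has not crashed. -/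
def seen (F : Adversary n t) (V : Fin n → Value) : ℕ → Fin n → Set Value
  | 0, i => {V i}
  | m + 1, i => F.seen V m i ∪ {x | ∃ j, F.delivers m j i = true ∧ x ∈ F.seen V m j}

/-- The number of messages to `i` that are missing in round `k + 1`. -/
noncomputable def lost (F : Adversary n t) (k : ℕ) (i : Fin n) : ℕ :=
  {j | F.delivers k j i = false}.ncard

/-- The record of missing-message counts kept by `i`. -/
noncomputable def history {H : Type} (h₀ : H) (record : H → ℕ → H) (F : Adversary n t)
    (i : Fin n) : ℕ → H
  | 0 => h₀
  | m + 1 => record (history h₀ record F i m) (F.lost m i)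

open Classical in
/-- The local state of agent `i` at time `m`. -/
noncomputable def localState {H : Type} (h₀ : H) (record : H → ℕ → H) (F : Adversary n t)
    (V : Fin n → Value) (m : ℕ) (i : Fin n) : LocalState H :=
  if F.Alive m i then .active (F.seen V m i) (F.history h₀ record i m) m (V i) else .crashed

variable {F F' : Adversary n t} {V V' : Fin n → Value} {m k : ℕ} {i j : Fin n}

theorem alive_zero : F.Alive 0 i := fun _ h => absurd h (Nat.not_lt_zero _)

theorem alive_succ : F.Alive (m + 1) i ↔ F.Alive m i ∧ F.delivers m i i = true := by
  refine ⟨fun h => ⟨fun k hk => h k (by omega), h m (by omega)⟩, fun h k hk => ?_⟩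
  rcases Nat.lt_succ_iff_lt_or_eq.1 hk with hk | rfl
  exacts [h.1 k hk, h.2]

theorem alive_of_delivers (h : F.delivers k j i = true) : F.Alive k j := by
  intro k' hk'
  by_contra hc
  rw [Bool.not_eq_true] at hc
  simp [F.silent_of_crash k' j hc k hk' i] at h

theorem Alive.delivers (h : F.Alive m i) (hk : k < m) (j : Fin n) :
    F.delivers k i j = true := by
  by_contra hc
  rw [Bool.not_eq_true] at hc
  simpa [F.crash_of_lost k i j hc] using h k hk

theorem exists_alive (ht : t < n) (F : Adversary n t) (m : ℕ) : ∃ i, F.Alive m i := by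
  by_contra! hc
  have h : {i : Fin n | ∃ k j, F.delivers k i j = false} = Set.univ := by
    ext i
    have := hc i
    simp only [Alive, not_forall, Bool.not_eq_true] at this
    obtain ⟨k, -, hk⟩ := this
    simpa using ⟨k, i, hk⟩
  have := F.faulty_le
  rw [h, Set.ncard_univ, Nat.card_fin] at this
  omega

theorem init_mem_seen (F : Adversary n t) (V : Fin n → Value) (m : ℕ) (i : Fin n) :
    V i ∈ F.seen V m i := by
  induction m with
  | zero => exact rfl
  | succ m ih => exact Or.inl ih

theorem exists_init_of_mem_seen {x : Value} (h : x ∈ F.seen V m i) : ∃ j, V j = x := by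
  induction m generalizing i with
  | zero => exact ⟨i, h.symm⟩
  | succ m ih =>
    rcases h with h | ⟨j, -, h⟩
    exacts [ih h, ih h]

theorem seen_mono {x : Value} (hk : k ≤ m) (h : x ∈ F.seen V k i) : x ∈ F.seen V m i := by
  induction m, hk using Nat.le_induction with
  | base => exact h
  | succ m _ ih => exact Or.inl ih

theorem seen_const (F : Adversary n t) (v : Value) (m : ℕ) (i : Fin n) :
    F.seen (fun _ => v) m i = {v} := by
  ext x
  constructor
  · intro h
    obtain ⟨-, rfl⟩ := exists_init_of_mem_seen h
    rfl
  · rintro rfl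
    exact F.init_mem_seen _ m i

theorem seen_congr (h : ∀ k < m, ∀ a b, F.delivers k a b = F'.delivers k a b) :
    F.seen V m i = F'.seen V m i := by
  induction m generalizing i with
  | zero => rfl
  | succ m ih =>
    have ih' : ∀ i, F.seen V m i = F'.seen V m i := fun i => ih fun k hk => h k (by omega)
    simp only [seen, ih', h m (Nat.lt_succ_self m)]

/-- What `i` has seen depends only on the messages received by `i` in the latest round and on
earlier rounds. -/
theorem seen_succ_congr (h : ∀ k < m, ∀ a b, F.delivers k a b = F'.delivers k a b)
    (hm : ∀ a, F.delivers m a i = F'.delivers m a i) :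
    F.seen V (m + 1) i = F'.seen V (m + 1) i := by
  have ih' : ∀ i, F.seen V m i = F'.seen V m i := fun i => seen_congr h
  simp only [seen, ih', hm]

theorem eq_or_eq_of_ne {v w : Value} (h : v ≠ w) (x : Value) : x = v ∨ x = w := by
  revert v w x; decide

/-- There are only two values, and the survivor `j` delivers its own to `i` in the first round. -/
theorem seen_eq_univ (hj : F.Alive m j) (hm : 0 < m) (h : V i ≠ V j) :
    F.seen V m i = Set.univ := by
  ext x
  simp only [Set.mem_univ, iff_true]
  rcases eq_or_eq_of_ne h x with rfl | rfl
  · exact F.init_mem_seen V m i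
  · exact seen_mono (k := 1) hm (Or.inr ⟨j, hj.delivers hm i, F.init_mem_seen V 0 j⟩)

theorem seen_eq_univ_or (F : Adversary n t) (V : Fin n → Value) (m : ℕ) (i : Fin n) :
    F.seen V m i = {V i} ∨ F.seen V m i = Set.univ := by
  by_cases h : ∃ x ∈ F.seen V m i, x ≠ V i
  · obtain ⟨x, hx, hne⟩ := h
    right
    ext y
    simp only [Set.mem_univ, iff_true]
    rcases eq_or_eq_of_ne hne y with rfl | rfl
    exacts [hx, F.init_mem_seen V m i]
  · push Not at h
    left
    ext y
    exact ⟨h y, by rintro rfl; exact F.init_mem_seen V m i⟩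

/-! ### Agreement -/

/-- All agents that have not crashed by time `m` have seen the same values. -/
def Agree (F : Adversary n t) (V : Fin n → Value) (m : ℕ) : Prop :=
  ∀ i j, F.Alive m i → F.Alive m j → F.seen V m i ⊆ F.seen V m j

theorem Agree.succ (h : F.Agree V m) : F.Agree V (m + 1) := by
  intro i j hi hj x hx
  rw [alive_succ] at hi hj
  refine Or.inl ?_
  rcases hx with hx | ⟨a, ha, hx⟩
  · exact h i j hi.1 hj.1 hx
  · exact h a j (alive_of_delivers ha) hj.1 hx

theorem Agree.mono (h : F.Agree V k) (hk : k ≤ m) : F.Agree V m := by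
  induction m, hk using Nat.le_induction with
  | base => exact h
  | succ m _ ih => exact ih.succ

/-- In a crash-free round, whatever a live agent has seen reaches everyone. -/
theorem agree_of_no_crash (h : ∀ a, F.Alive k a → F.delivers k a a = true) :
    F.Agree V (k + 1) := by
  intro i j hi hj x hx
  have key : ∀ a, F.Alive k a → x ∈ F.seen V k a → x ∈ F.seen V (k + 1) j := fun a ha hxa =>
    Or.inr ⟨a, (alive_succ.2 ⟨ha, h a ha⟩).delivers (Nat.lt_succ_self k) j, hxa⟩
  rcases hx with hx | ⟨a, ha, hx⟩
  · exact key i (alive_succ.1 hi).1 hx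
  · exact key a (alive_of_delivers ha) hx

theorem agree_of_le (hm : min (t + 1) (n - 1) ≤ m) : F.Agree V m := by
  by_cases hclean : ∃ k < m, ∀ a, F.Alive k a → F.delivers k a a = true
  · obtain ⟨k, hk, h⟩ := hclean
    exact (agree_of_no_crash h).mono hk
  push Not at hclean
  intro i j hi hj
  by_cases hij : i = j
  · rw [hij]
  exfalso
  -- One crashing agent per round, all distinct, gives `m ≤ t`. Together with the two survivors they
  -- also give `m + 2 ≤ n`, contradicting the bound on `m`.
  have : ∀ k : Fin m, ∃ a, F.Alive k a ∧ F.delivers k a a = false := fun k => by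
    simpa using hclean k k.2
  choose f hf hf' using this
  have hinj : Function.Injective f := by
    have key : ∀ k l : Fin m, k < l → f k ≠ f l := by
      intro k l hkl he
      have h1 := hf l k hkl
      rw [← he, hf' k] at h1
      cases h1
    intro k l he
    by_contra hne
    rcases lt_or_gt_of_ne hne with h | h
    exacts [key k l h he, key l k h he.symm]
  have h1 : (Set.range f).ncard = m := by
    rw [← Set.image_univ, Set.ncard_image_of_injective _ hinj, Set.ncard_univ, Nat.card_fin]
  have h2 : (Set.range f).ncard ≤ t := by
    refine le_trans (Set.ncard_le_ncard ?_ (Set.toFinite _)) F.faulty_le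
    rintro _ ⟨k, rfl⟩
    exact ⟨k, f k, hf' k⟩
  have hni : ∀ a, F.Alive m a → a ∉ Set.range f := by
    rintro _ ha ⟨k, rfl⟩
    have := ha k k.2
    rw [hf' k] at this
    cases this
  have h3 : (insert i (insert j (Set.range f))).ncard ≤ n := by
    simpa using Set.ncard_le_card (insert i (insert j (Set.range f)))
  rw [Set.ncard_insert_of_notMem (by simpa [hij] using hni i hi),
    Set.ncard_insert_of_notMem (hni j hj)] at h3
  omega

theorem eq_of_lost (hi : F.Alive m i) (hk : k < m) (h : n - 1 ≤ F.lost k i) (hj : F.Alive m j) :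
    j = i := by
  by_contra hne
  have hi' : i ∉ {a | F.delivers k a i = false} := by simp [hi.delivers hk i]
  have hj' : j ∉ insert i {a | F.delivers k a i = false} := by simp [hne, hj.delivers hk i]
  have h3 : (insert j (insert i {a | F.delivers k a i = false})).ncard ≤ n := by
    simpa using Set.ncard_le_card (insert j (insert i {a | F.delivers k a i = false}))
  rw [Set.ncard_insert_of_notMem hj', Set.ncard_insert_of_notMem hi'] at h3
  unfold lost at h
  omega

/-- A missing message reveals a crash, and crashed agents stay silent. Hence the latest count
dominates all earlier ones, and remembering those does not help. -/
theorem lost_mono {l : ℕ} (hkl : k ≤ l) : F.lost k i ≤ F.lost l i := by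
  refine Set.ncard_le_ncard (fun j hj => ?_) (Set.toFinite _)
  rcases hkl.eq_or_lt with rfl | h
  · exact hj
  · exact F.silent_of_crash k j (F.crash_of_lost k j i hj) l h i

/-! ### Indistinguishability -/

/-- Some agent that has not crashed by time `m` has the same initial value, has seen the same
values, and has missed the same numbers of messages in two runs. -/
def Similar (m : ℕ) (p q : Adversary n t × (Fin n → Value)) : Prop :=
  ∃ i, p.1.Alive m i ∧ q.1.Alive m i ∧ p.2 i = q.2 i ∧ p.1.seen p.2 m i = q.1.seen q.2 m i ∧
    ∀ k < m, p.1.lost k i = q.1.lost k i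

/-- The reflexive and transitive closure of `Similar`. -/
def Linked (m : ℕ) : Adversary n t × (Fin n → Value) → Adversary n t × (Fin n → Value) → Prop :=
  Relation.ReflTransGen (Similar m)

theorem Similar.symm {p q : Adversary n t × (Fin n → Value)} (h : Similar m p q) :
    Similar m q p := by
  obtain ⟨i, h1, h2, h3, h4, h5⟩ := h
  exact ⟨i, h2, h1, h3.symm, h4.symm, fun k hk => (h5 k hk).symm⟩

theorem Linked.symm {p q : Adversary n t × (Fin n → Value)} (h : Linked m p q) :
    Linked m q p :=
  have : Std.Symm (Similar (n := n) (t := t) m) := ⟨fun _ _ => Similar.symm⟩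
  Std.Symm.symm (r := Relation.ReflTransGen (Similar m)) _ _ h

theorem Linked.trans {p q s : Adversary n t × (Fin n → Value)} (h : Linked m p q)
    (h' : Linked m q s) : Linked m p s :=
  Relation.ReflTransGen.trans h h'

theorem linked_of_seen (hi : F.Alive m i) (hV : V i = V' i)
    (hs : F.seen V m i = F.seen V' m i) : Linked m (F, V) (F, V') :=
  .single ⟨i, hi, hi, hV, hs, fun _ _ => rfl⟩

theorem lost_congr (h : ∀ a, F.delivers k a i = F'.delivers k a i) : F.lost k i = F'.lost k i := by
  simp only [lost, h]

/-! ### Changing the behaviour of one agent -/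

/-- The adversary that lets `a` through unharmed, and otherwise behaves like `F`. -/
def heal (F : Adversary n t) (a : Fin n) : Adversary n t where
  delivers k b j := if b = a then true else F.delivers k b j
  crash_of_lost k b j := by
    split_ifs
    exacts [id, F.crash_of_lost k b j]
  silent_of_crash k b := by
    split_ifs with h
    · simp
    · exact F.silent_of_crash k b
  faulty_le := by
    refine le_trans (Set.ncard_le_ncard ?_ (Set.toFinite _)) F.faulty_le
    rintro b ⟨k, j, h⟩
    split_ifs at h
    exact ⟨k, j, h⟩

/-- The adversary that crashes the faulty agent `a` in round `c + 1`, after delivery of its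
messages to the agents `j` with `d j = true`, and otherwise behaves like `F`. -/
def crashAt (F : Adversary n t) (a : Fin n) (ha : ∃ k, F.delivers k a a = false) (c : ℕ)
    (d : Fin n → Bool) : Adversary n t where
  delivers k b j :=
    -- Excluding `j ≠ a` from delivery in round `c + 1` is what records the crash: the message of
    -- `a` to itself is lost.
    if b = a then decide (k < c ∨ k = c ∧ j ≠ a ∧ d j = true) else F.delivers k b j
  crash_of_lost k b j := by
    split_ifs with h
    · subst h
      simp only [decide_eq_false_iff_not]
      grind
    · exact F.crash_of_lost k b j
  silent_of_crash k b := by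
    split_ifs with h
    · subst h
      simp only [decide_eq_false_iff_not]
      grind
    · exact F.silent_of_crash k b
  faulty_le := by
    refine le_trans (Set.ncard_le_ncard ?_ (Set.toFinite _)) F.faulty_le
    rintro b ⟨k, j, h⟩
    split_ifs at h with hb
    · subst hb
      obtain ⟨k, hk⟩ := ha
      exact ⟨k, b, hk⟩
    · exact ⟨k, j, h⟩

theorem Alive.heal (a : Fin n) (h : F.Alive m i) : (F.heal a).Alive m i := by
  intro k hk
  simp [Adversary.heal, h k hk]

theorem alive_heal_self (F : Adversary n t) (a : Fin n) (m : ℕ) : (F.heal a).Alive m a := by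
  intro k hk
  simp [heal]

theorem Alive.crashAt {a : Fin n} (ha : ∃ k, F.delivers k a a = false) (c : ℕ)
    (d : Fin n → Bool) (hi : i ≠ a) (h : F.Alive m i) : (F.crashAt a ha c d).Alive m i := by
  intro k hk
  simp [Adversary.crashAt, h k hk, hi]

theorem exists_eq_crashAt {a : Fin n} (ha : ∃ k, F.delivers k a a = false) :
    ∃ c d, F = F.crashAt a ha c d := by
  classical
  -- The crash round is the first one in which `a` loses its message to itself: all is delivered
  -- before it and nothing after it.
  refine ⟨Nat.find ha, F.delivers (Nat.find ha) a, ?_⟩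
  have hspec := Nat.find_spec ha
  have hmin : ∀ k < Nat.find ha, ∀ b, F.delivers k a b = true := by
    intro k hk b
    by_contra hc
    rw [Bool.not_eq_true] at hc
    exact Nat.find_min ha hk (F.crash_of_lost k a b hc)
  ext k b j
  by_cases hb : b = a
  · subst hb
    simp only [crashAt, if_true]
    rcases lt_trichotomy k (Nat.find ha) with h | h | h
    · simp [hmin k h, h]
    · by_cases hj : j = b
      · rw [hj, h, hspec]
        simp
      · simp only [h, hj, lt_irrefl, false_or, true_and, not_false_eq_true, ne_eq]
        cases F.delivers (Nat.find ha) b j <;> simp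
    · rw [F.silent_of_crash _ b hspec k h j]
      simp [h.not_gt, h.ne']
  · simp [crashAt, hb]

/-- What `i` and `j` have seen does not depend on the adversary. -/
def Insensitive (t : ℕ) (V : Fin n → Value) (m : ℕ) (i j : Fin n) : Prop :=
  ∀ F F' : Adversary n t, F.Alive m i → F.Alive m j → F'.Alive m i → F'.Alive m j →
    F.seen V m i = F'.seen V m i ∧ F.seen V m j = F'.seen V m j

theorem insensitive_const (t : ℕ) (v : Value) (m : ℕ) (i j : Fin n) :
    Insensitive t (fun _ => v) m i j :=
  fun F F' _ _ _ _ => ⟨by simp only [seen_const], by simp only [seen_const]⟩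

theorem insensitive_of_ne (t : ℕ) (hm : 0 < m) (h : V i ≠ V j) : Insensitive t V m i j :=
  fun F F' hi hj hi' hj' => by
    rw [seen_eq_univ hj hm h, seen_eq_univ hj' hm h, seen_eq_univ hi hm h.symm,
      seen_eq_univ hi' hm h.symm]
    exact ⟨rfl, rfl⟩

/-- As long as two agents survive and only counts matter, the crash of a third agent can be
postponed past the horizon: one of the survivors cannot tell to whom else the crashing agent
delivered its last messages, and the other one cannot tell a crash right after a round from a crash
in the next round in which it misses the message. -/
theorem linked_crashAt_heal {a : Fin n} (hV : Insensitive t V m i j) (hij : i ≠ j)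
    (hi : F.Alive m i) (hj : F.Alive m j) (hia : i ≠ a) (hja : j ≠ a)
    (ha : ∃ k, F.delivers k a a = false) (c : ℕ) (d : Fin n → Bool) :
    Linked m (F.crashAt a ha c d, V) (F.heal a, V) := by
  by_cases hc : m ≤ c
  · refine .single ⟨i, hi.crashAt ha c d hia, hi.heal a, rfl, ?_, fun k hk => lost_congr fun b => ?_⟩
    · exact (hV _ _ (hi.crashAt ha c d hia) (hj.crashAt ha c d hja) (hi.heal a) (hj.heal a)).1
    · have : k < c := by omega
      simp [crashAt, heal, this]
  -- First `i` hides the change of `d` to delivery to everybody else, in particular to `j`; then `j`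
  -- hides the shift of the crash by one round.
  · refine Linked.trans (q := (F.crashAt a ha c (Function.update (fun _ => true) i (d i)), V)) ?_
      (Linked.trans (q := (F.crashAt a ha (c + 1) (fun _ => false), V)) ?_
        (linked_crashAt_heal hV hij hi hj hia hja ha (c + 1) _))
    · refine .single ⟨i, hi.crashAt ha _ _ hia, hi.crashAt ha _ _ hia, rfl, ?_,
        fun k hk => lost_congr fun b => ?_⟩
      · exact (hV _ _ (hi.crashAt ha _ _ hia) (hj.crashAt ha _ _ hja) (hi.crashAt ha _ _ hia)
          (hj.crashAt ha _ _ hja)).1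
      · simp [crashAt]
    · refine .single ⟨j, hj.crashAt ha _ _ hja, hj.crashAt ha _ _ hja, rfl, ?_,
        fun k hk => lost_congr fun b => ?_⟩
      · exact (hV _ _ (hi.crashAt ha _ _ hia) (hj.crashAt ha _ _ hja) (hi.crashAt ha _ _ hia)
          (hj.crashAt ha _ _ hja)).2
      · by_cases hb : b = a
        · simp only [crashAt, hb, if_true, Function.update_of_ne hij.symm, hja, ne_eq,
            not_false_eq_true, and_true, Bool.false_eq_true, and_false, or_false]
          congr 1
          simp only [eq_iff_iff]
          omega
        · simp [crashAt, hb]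
termination_by m - c

theorem linked_heal (hV : Insensitive t V m i j) (hij : i ≠ j) (hi : F.Alive m i)
    (hj : F.Alive m j) (a : Fin n) : Linked m (F, V) (F.heal a, V) := by
  by_cases ha : F.Alive m a
  · refine .single ⟨i, hi, hi.heal a, rfl, (hV _ _ hi hj (hi.heal a) (hj.heal a)).1,
      fun k hk => lost_congr fun b => ?_⟩
    by_cases hb : b = a
    · simp [heal, hb, ha.delivers hk]
    · simp [heal, hb]
  · have hia : i ≠ a := by rintro rfl; exact ha hi
    have hja : j ≠ a := by rintro rfl; exact ha hj
    have ha' : ∃ k, F.delivers k a a = false := by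
      simp only [Alive, not_forall, Bool.not_eq_true] at ha
      obtain ⟨k, -, hk⟩ := ha
      exact ⟨k, hk⟩
    obtain ⟨c, d, he⟩ := exists_eq_crashAt ha'
    have := linked_crashAt_heal hV hij hi hj hia hja ha' c d
    rwa [← he] at this

/-- The failure-free adversary. -/
def failureFree (n t : ℕ) : Adversary n t where
  delivers _ _ _ := true
  crash_of_lost _ _ _ := id
  silent_of_crash _ _ h := by cases h
  faulty_le := by simp

theorem alive_failureFree (n t m : ℕ) (i : Fin n) : (failureFree n t).Alive m i :=
  fun _ _ => rfl

/-- Agents are healed one at a time; healing keeps `i` and `j` alive, and `Insensitive` does not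
depend on the adversary. -/
theorem linked_failureFree (hV : Insensitive t V m i j) (hij : i ≠ j) (hi : F.Alive m i)
    (hj : F.Alive m j) : Linked m (F, V) (failureFree n t, V) := by
  have key : ∀ s : Finset (Fin n), ∃ G : Adversary n t, Linked m (F, V) (G, V) ∧ G.Alive m i ∧
      G.Alive m j ∧ ∀ a ∈ s, ∀ k b, G.delivers k a b = true := by
    intro s
    induction s using Finset.induction_on with
    | empty => exact ⟨F, .refl, hi, hj, by simp⟩
    | insert a s _ ih =>
      obtain ⟨G, h1, h2, h3, h4⟩ := ih
      refine ⟨G.heal a, h1.trans (linked_heal hV hij h2 h3 a), h2.heal a, h3.heal a, ?_⟩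
      intro b hb k x
      by_cases hba : b = a
      · simp [heal, hba]
      · simpa [heal, hba] using h4 b ((Finset.mem_insert.1 hb).resolve_left hba) k x
  obtain ⟨G, h1, -, -, h4⟩ := key Finset.univ
  have : G = failureFree n t := by
    ext k a b
    rw [h4 a (Finset.mem_univ a) k b]
    rfl
  rwa [← this]

/-! ### Hiding an initial value -/

/-- The adversary that crashes, for each `k < m`, the agent `a k` in round `k + 1`, in which it
delivers its message to `a (k + 1)` only. -/
def chain (a : ℕ → Fin n) (m : ℕ) (ha : Set.InjOn a (Set.Iic m)) (hm : m ≤ t) :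
    Adversary n t where
  delivers k x y :=
    decide ((∀ l ≤ k, l < m → x ≠ a l) ∨ k < m ∧ x = a k ∧ y = a (k + 1))
  crash_of_lost k x y := by
    simp only [decide_eq_false_iff_not, not_or]
    rintro ⟨h1, -⟩
    refine ⟨h1, ?_⟩
    rintro ⟨h2, h3, h4⟩
    have := ha (Set.mem_Iic.2 h2.le) (Set.mem_Iic.2 h2) (h3.symm.trans h4)
    omega
  silent_of_crash k x := by
    simp only [decide_eq_false_iff_not, not_or]
    rintro ⟨h1, -⟩ k' hk y
    push Not at h1
    obtain ⟨l, hl, hlm, rfl⟩ := h1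
    refine ⟨fun h => h l (by omega) hlm rfl, ?_⟩
    rintro ⟨h2, h3, -⟩
    have := ha (Set.mem_Iic.2 hlm.le) (Set.mem_Iic.2 h2.le) h3
    omega
  faulty_le := by
    have h : (a '' Set.Iio m).ncard ≤ t := by
      refine (Set.ncard_image_le (Set.toFinite _)).trans ?_
      rw [← Finset.coe_Iio, Set.ncard_coe_finset, Nat.card_Iio]
      exact hm
    refine le_trans (Set.ncard_le_ncard ?_ (Set.toFinite _)) h
    rintro x ⟨k, y, hx⟩
    simp only [decide_eq_false_iff_not, not_or] at hx
    obtain ⟨h1, -⟩ := hx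
    push Not at h1
    obtain ⟨l, -, hlm, rfl⟩ := h1
    exact ⟨l, hlm, rfl⟩

section chain

variable {a : ℕ → Fin n} {ha : Set.InjOn a (Set.Iic m)} {hm : m ≤ t}

theorem alive_chain (h : ∀ l < m, i ≠ a l) : (chain a m ha hm).Alive m i := by
  intro k hk
  simp only [chain, decide_eq_true_eq]
  exact Or.inl fun l _ hl => h l hl

theorem mem_seen_chain (hk : k ≤ m) : V (a 0) ∈ (chain a m ha hm).seen V k (a k) := by
  induction k with
  | zero => exact rfl
  | succ k ih =>
    exact Or.inr ⟨a k, decide_eq_true (Or.inr ⟨hk, rfl, rfl⟩), ih (by omega)⟩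

/-- The value of `a 0` moves one link per round, and each holder crashes after passing it on, so by
time `k` it has not left `a 0, …, a k`. -/
theorem notMem_seen_chain {v : Value} (hV : ∀ x, x ≠ a 0 → V x ≠ v) (hk : k ≤ m)
    (hi : ∀ l ≤ k, i ≠ a l) : v ∉ (chain a m ha hm).seen V k i := by
  induction k generalizing i with
  | zero => exact fun h => hV i (hi 0 le_rfl) (Eq.symm h)
  | succ k ih =>
    rintro (h | ⟨b, hb, h⟩)
    · exact ih (by omega) (fun l hl => hi l (by omega)) h
    · simp only [chain, decide_eq_true_eq] at hb
      rcases hb with hb | ⟨-, -, hb⟩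
      · exact ih (by omega) (fun l hl => hb l hl (by omega)) h
      · exact hi (k + 1) le_rfl hb

end chain

theorem exists_injOn (hm : m + 2 ≤ n) (hij : i ≠ j) :
    ∃ a : ℕ → Fin n, Set.InjOn a (Set.Iic m) ∧ a m = i ∧ ∀ l, a l ≠ j := by
  classical
  have hcard : Fintype.card (Fin m) ≤ Fintype.card {x : Fin n // x ∉ ({i, j} : Finset (Fin n))} := by
    rw [Fintype.card_fin, Fintype.card_subtype_compl, Fintype.card_fin, Fintype.card_coe,
      Finset.card_pair hij]
    omega
  obtain ⟨f⟩ := Function.Embedding.nonempty_of_card_le hcard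
  have hf : ∀ l, (f l : Fin n) ≠ i ∧ (f l : Fin n) ≠ j := fun l => by simpa using (f l).2
  refine ⟨fun k => if h : k < m then f ⟨k, h⟩ else i, ?_, by simp, ?_⟩
  · intro k hk l hl he
    rw [Set.mem_Iic] at hk hl
    by_cases h1 : k < m <;> by_cases h2 : l < m
    · simp only [h1, h2, dif_pos] at he
      simpa using f.injective (Subtype.ext he)
    · simp only [h1, h2, dif_pos, dif_neg, not_false_eq_true] at he
      exact absurd he (hf _).1
    · simp only [h1, h2, dif_pos, dif_neg, not_false_eq_true] at he
      exact absurd he.symm (hf _).1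
    · omega
  · intro l
    dsimp only
    split_ifs
    exacts [(hf _).2, hij]

/-- The initial values in which `i` has `v` and all other agents have the other value. -/
def oneOff (i : Fin n) (v : Value) : Fin n → Value := fun x => if x = i then v else 1 - v

theorem one_sub_ne (v : Value) : 1 - v ≠ v := by
  revert v; decide

theorem oneOff_self (i : Fin n) (v : Value) : oneOff i v i = v := if_pos rfl

theorem oneOff_of_ne (v : Value) (h : j ≠ i) : oneOff i v j = 1 - v := if_neg h

theorem oneOff_ne (v : Value) (h : i ≠ j) : oneOff i v i ≠ oneOff i v j := by
  rw [oneOff_self, oneOff_of_ne v h.symm]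
  exact (one_sub_ne v).symm

/-- Under a chain of crashes ending in `i` and avoiding `j`, flipping the value of `a 0` goes
unnoticed by `j` but reaches `i` at time `m`. Having seen both values, `i` cannot exclude that all
others started with `1 - v`. The bounds on `m` provide the `m` crashing agents besides `i` and `j`.
-/
theorem linked_const_oneOff (hm : 0 < m) (hmt : m ≤ t) (hmn : m + 2 ≤ n) (hij : i ≠ j)
    (v : Value) :
    Linked m (failureFree n t, fun _ => v) (failureFree n t, oneOff i v) := by
  obtain ⟨a, ha, hai, haj⟩ := exists_injOn hmn hij
  have hi : (chain a m ha hmt).Alive m i := alive_chain fun l hl he => by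
    have := ha (Set.mem_Iic.2 le_rfl) (Set.mem_Iic.2 hl.le) (hai.trans he)
    omega
  have hj : (chain a m ha hmt).Alive m j := alive_chain fun l _ => (haj l).symm
  have h0 : a 0 ≠ i := fun he => by
    have := ha (Set.mem_Iic.2 le_rfl) (Set.mem_Iic.2 hm.le) (hai.trans he.symm)
    omega
  have hV : ∀ x, x ≠ a 0 → Function.update (fun _ => v) (a 0) (1 - v) x = v := fun x hx => by
    rw [Function.update_of_ne hx]
  have hVi := hV i h0.symm
  have hVj := hV j (haj 0).symm
  refine Linked.trans (q := (chain a m ha hmt, fun _ => v))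
    (linked_failureFree (insensitive_const t v m i j) hij hi hj).symm ?_
  refine Linked.trans (q := (chain a m ha hmt, Function.update (fun _ => v) (a 0) (1 - v)))
    (linked_of_seen hj hVj.symm ?_) ?_
  · rw [seen_const]
    rcases (chain a m ha hmt).seen_eq_univ_or
      (Function.update (fun _ => v) (a 0) (1 - v)) m j with h | h
    · rw [h, hVj]
    · have := notMem_seen_chain (ha := ha) (hm := hmt) (v := 1 - v)
        (V := Function.update (fun _ => v) (a 0) (1 - v)) (i := j)
        (fun x hx => by rw [hV x hx]; exact (one_sub_ne v).symm) (le_refl m)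
        (fun l _ => (haj l).symm)
      rw [h] at this
      exact absurd (Set.mem_univ _) this
  · refine Linked.trans (q := (chain a m ha hmt, oneOff i v)) (linked_of_seen hi ?_ ?_)
      (linked_failureFree (insensitive_of_ne t hm (oneOff_ne v hij)) hij hi hj)
    · rw [hVi, oneOff_self]
    · rw [seen_eq_univ hj hm (oneOff_ne v hij)]
      rcases (chain a m ha hmt).seen_eq_univ_or
        (Function.update (fun _ => v) (a 0) (1 - v)) m i with h | h
      · have := mem_seen_chain (ha := ha) (hm := hmt)
          (V := Function.update (fun _ => v) (a 0) (1 - v)) (le_refl m)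
        rw [Function.update_self, hai, h, hVi] at this
        exact absurd this (one_sub_ne v)
      · exact h

/-- Agent `j` starts with `1 - v` on both sides and has seen both values after one round. -/
theorem linked_oneOff_oneOff (hm : 0 < m) (hij : i ≠ j) (v : Value) :
    Linked m (failureFree n t, oneOff i v) (failureFree n t, oneOff j (1 - v)) := by
  refine linked_of_seen (alive_failureFree n t m j) ?_ ?_
  · rw [oneOff_self, oneOff_of_ne v hij.symm]
  · rw [seen_eq_univ (alive_failureFree n t m i) hm
      (oneOff_ne v hij).symm, seen_eq_univ
      (alive_failureFree n t m i) hm (oneOff_ne _ hij.symm)]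

/-- The failure-free runs with constant initial values are linked with each other. -/
theorem linked_const_const (hm : 0 < m) (hmt : m ≤ t) (hmn : m + 2 ≤ n) (v w : Value) :
    Linked m (failureFree n t, fun _ => v) (failureFree n t, fun _ => w) := by
  have hij : (⟨0, by omega⟩ : Fin n) ≠ ⟨1, by omega⟩ := by simp
  by_cases h : w = v
  · rw [h]
    exact .refl
  · have hw : w = 1 - v := (eq_or_eq_of_ne (one_sub_ne v) w).resolve_right h
    subst hw
    exact ((linked_const_oneOff hm hmt hmn hij v).trans (linked_oneOff_oneOff hm hij v)).trans
      (linked_const_oneOff hm hmt hmn hij.symm (1 - v)).symm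

theorem exists_delivers_of_lost (hk : F.lost k i < n - 1) :
    ∃ j, j ≠ i ∧ F.delivers k j i = true := by
  by_contra! hc
  have h : ({i}ᶜ : Set (Fin n)) ⊆ {j | F.delivers k j i = false} := fun j hj => by
    simpa using hc j hj
  have h1 := Set.ncard_le_ncard h (Set.toFinite _)
  rw [Set.ncard_compl, Set.ncard_singleton, Nat.card_fin] at h1
  unfold lost at hk
  omega

/-- Unless the stopping condition holds, every run is linked with one in which the initial values
are constant with an arbitrarily prescribed value. -/
theorem exists_linked_const (hm : m < min (t + 1) (n - 1)) (hi : F.Alive m i)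
    (hlost : ∀ k < m, F.lost k i < n - 1) (V : Fin n → Value) (w : Value) :
    ∃ G, Linked m (F, V) (G, fun _ => w) := by
  have hmt : m ≤ t := by omega
  have hmn : m + 2 ≤ n := by omega
  rcases Nat.eq_zero_or_pos m with rfl | hpos
  · have : Nontrivial (Fin n) := Fin.nontrivial_iff_two_le.2 (by omega)
    obtain ⟨j, hji⟩ := exists_ne i
    -- At time `0` an agent knows only its own value: `i` hides the change of all others to `w`,
    -- then `j` hides that of `i`.
    refine ⟨F, (linked_of_seen (i := i) (V' := fun x => if x = i then V i else w) hi ?_ ?_).trans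
      (linked_of_seen (i := j) alive_zero ?_ ?_)⟩ <;> simp [seen, hji]
  · obtain ⟨m, rfl⟩ : ∃ l, m = l + 1 := ⟨m - 1, by omega⟩
    obtain ⟨j, hji, hdel⟩ := exists_delivers_of_lost (hlost m (Nat.lt_succ_self m))
    have hjm := alive_of_delivers hdel
    -- Since `j` still reached `i` in the last round, `i` cannot tell whether `j` crashed in that
    -- round, so `j` may be healed.
    have hheal : ∀ k < m, ∀ b x, F.delivers k b x = (F.heal j).delivers k b x := fun k hk b x => by
      by_cases hb : b = j
      · simp [heal, hb, hjm.delivers hk]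
      · simp [heal, hb]
    have hheal' : ∀ b, F.delivers m b i = (F.heal j).delivers m b i := fun b => by
      by_cases hb : b = j
      · simp [heal, hb, hdel]
      · simp [heal, hb]
    have h1 : Linked (m + 1) (F, V) (F.heal j, V) := by
      refine .single ⟨i, hi, hi.heal j, rfl, seen_succ_congr hheal hheal', fun k hk =>
        lost_congr fun b => ?_⟩
      rcases Nat.lt_succ_iff_lt_or_eq.1 hk with hk | rfl
      exacts [hheal k hk b i, hheal' b]
    have hi' := hi.heal j
    have hj' := F.alive_heal_self j (m + 1)
    have h2 : Linked (m + 1) (F.heal j, V) (failureFree n t, fun _ => V i) := by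
      -- If `i` has seen only its own value, all values may be equal to it; if it has seen both, it
      -- may be the only one with its value. Either way `Insensitive` holds for `i` and `j`.
      rcases (F.heal j).seen_eq_univ_or V (m + 1) i with h | h
      · refine (linked_of_seen (V' := fun _ => V i) hi' rfl ?_).trans
          (linked_failureFree (insensitive_const t (V i) _ i j) hji.symm hi' hj')
        rw [h, seen_const]
      · refine ((linked_of_seen hi' (oneOff_self i (V i)).symm ?_).trans
          (linked_failureFree (insensitive_of_ne t hpos (oneOff_ne (V i) hji.symm)) hji.symm
            hi' hj')).trans (linked_const_oneOff hpos hmt hmn hji.symm (V i)).symm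
        rw [h, seen_eq_univ hj' hpos (oneOff_ne (V i) hji.symm)]
    exact ⟨_, (h1.trans h2).trans (linked_const_const hpos hmt hmn (V i) w)⟩

end Adversary

/-! ### Runs of the counting variants of FloodSet -/

/-- The variant of FloodSet with initial record `h₀` and update `record` of the record. -/
noncomputable def floodExchange {H : Type} (n t : ℕ) (h₀ : H) (record : H → ℕ → H) :
    InfoExchange n t where
  L := LocalState H
  M := Set Value
  crashed := .crashed
  start _ v := .active {v} h₀ 0 v
  send _ s _ _ := floodSend s
  update i s F _ msgs := floodUpdate record i s F msgs

section runs

variable {H : Type} {h₀ : H} {record : H → ℕ → H}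

open Adversary

/-- A delivered message has a live sender, so the crashed branch of `floodSend` never matters here.
-/
theorem floodSend_localState {F : Adversary n t} {V : Fin n → Value} {m : ℕ} {i j : Fin n} :
    (if F.delivers m j i = true then floodSend (F.localState h₀ record V m j) else none) =
      if F.delivers m j i = true then some (F.seen V m j) else none := by
  split_ifs with h
  · simp [localState, alive_of_delivers h, floodSend]
  · rfl

theorem floodUpdate_localState (F : Adversary n t) (V : Fin n → Value) (m : ℕ) (i : Fin n) :
    floodUpdate record i (F.localState h₀ record V m i) F
        (fun j => if F.delivers m j i = true then floodSend (F.localState h₀ record V m j)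
          else none) = F.localState h₀ record V (m + 1) i := by
  simp only [floodSend_localState]
  by_cases hi : F.Alive m i
  · by_cases hd : F.delivers m i i = true
    · simp only [localState, hi, alive_succ, hd, and_self, if_true, floodUpdate, history, seen]
      congr 1
      · congr 1
        ext x
        simp only [Set.mem_ofPred_eq]
        refine exists_congr fun j => ?_
        split_ifs with h <;> simp [h]
      · congr 1
        simp [missing, lost]
    · simp [localState, hi, alive_succ, hd, floodUpdate]
  · simp [localState, hi, alive_succ, floodUpdate]

/-- The run with the given adversary and initial values. -/
noncomputable def runOf (h₀ : H) (record : H → ℕ → H) (F : Adversary n t) (V : Fin n → Value) :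
    Run (floodExchange n t h₀ record) :=
  fun m => (F, F.localState h₀ record V m)

theorem localState_zero (F : Adversary n t) (V : Fin n → Value) (i : Fin n) :
    F.localState h₀ record V 0 i = .active {V i} h₀ 0 (V i) := by
  simp [localState, alive_zero, seen, history]

variable {P : DecisionProtocol (floodExchange n t h₀ record)}

theorem runOf_mem_system (F : Adversary n t) (V : Fin n → Value) :
    runOf h₀ record F V ∈ system (floodExchange n t h₀ record) P :=
  ⟨⟨V, fun i => localState_zero F V i⟩, fun k => ⟨rfl, fun i =>
    (floodUpdate_localState F V k i).symm⟩⟩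

theorem exists_eq_runOf {r : Run (floodExchange n t h₀ record)}
    (hr : r ∈ system (floodExchange n t h₀ record) P) : ∃ V, r = runOf h₀ record (r 0).1 V := by
  obtain ⟨⟨V, hV⟩, hstep⟩ := hr
  refine ⟨V, funext fun m => ?_⟩
  induction m with
  | zero => exact Prod.ext rfl (funext fun i => (hV i).trans (localState_zero _ V i).symm)
  | succ m ih =>
    obtain ⟨h1, h2⟩ := hstep m
    refine Prod.ext (h1.trans (congrArg Prod.fst ih :)) (funext fun i => (h2 i).trans ?_)
    rw [ih]
    exact floodUpdate_localState _ V m i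

theorem mem_nonfailed_runOf {F : Adversary n t} {V : Fin n → Value} {m : ℕ} {i : Fin n} :
    i ∈ nonfailed (runOf h₀ record F V) m ↔ F.Alive m i := by
  by_cases h : F.Alive m i <;>
    simp [nonfailed, runOf, localState, h, floodExchange]

theorem someInit_runOf {F : Adversary n t} {V : Fin n → Value} {m : ℕ} {v : Value} :
    someInit v (runOf h₀ record F V) m ↔ ∃ i, V i = v := by
  refine exists_congr fun i => ?_
  change F.localState h₀ record V 0 i = LocalState.active {v} h₀ 0 v ↔ _
  rw [localState_zero]
  constructor
  · intro h
    injection h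
  · rintro rfl
    rfl

theorem localState_eq_iff {F F' : Adversary n t} {V V' : Fin n → Value} {m m' : ℕ} {i : Fin n}
    (hi : F.Alive m i) :
    F.localState h₀ record V m i = F'.localState h₀ record V' m' i ↔
      F'.Alive m' i ∧ F.seen V m i = F'.seen V' m' i ∧
        F.history h₀ record i m = F'.history h₀ record i m' ∧ m = m' ∧ V i = V' i := by
  by_cases h : F'.Alive m' i <;> simp [localState, hi, h]

theorem history_congr {F F' : Adversary n t} {m : ℕ} {i : Fin n}
    (h : ∀ k < m, F.lost k i = F'.lost k i) :
    F.history h₀ record i m = F'.history h₀ record i m := by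
  induction m with
  | zero => rfl
  | succ m ih => rw [history, history, ih fun k hk => h k (by omega), h m (Nat.lt_succ_self m)]

end runs

/-! ### Common knowledge -/

section commonKnowledge

variable {E : InfoExchange n t} {R : Set (Run E)} {φ : Formula E} {r r' : Run E} {m m' : ℕ}
  {i : Fin n}

/-- Level `k` at the new point comes from level `k + 1` at the old one. -/
theorem CommonKnowledge.of_eq (h : CommonKnowledge R φ r m) (hi : i ∈ nonfailed r m)
    (hr' : r' ∈ R) (he : (r m).2 i = (r' m').2 i) : CommonKnowledge R φ r' m' := by
  intro k hk
  have := h (k + 1) (by omega)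
  rw [Function.iterate_succ_apply'] at this
  exact this i hi r' hr' m' he

theorem CommonKnowledge.holds (h : CommonKnowledge R φ r m) (hr : r ∈ R)
    (hi : i ∈ nonfailed r m) : φ r m :=
  h 1 le_rfl i hi r hr m rfl

/-- The induction rule for common knowledge. -/
theorem commonKnowledge_of_invariant (S : Set (Run E × ℕ)) (hS : (r, m) ∈ S)
    (hφ : ∀ r m, (r, m) ∈ S → φ r m)
    (hinv : ∀ r m, (r, m) ∈ S → ∀ i ∈ nonfailed r m, ∀ r' ∈ R, ∀ m', (r m).2 i = (r' m').2 i →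
      (r', m') ∈ S) : CommonKnowledge R φ r m := by
  have key : ∀ k r m, (r, m) ∈ S → ((EveryoneKnows R)^[k] φ) r m := by
    intro k
    induction k with
    | zero => exact hφ
    | succ k ih =>
      intro r m h
      rw [Function.iterate_succ_apply']
      exact fun i hi r' hr' m' he => ih r' m' (hinv r m h i hi r' hr' m' he)
  exact fun k _ => key k r m hS

end commonKnowledge

/-! ### The stopping condition and its two instances -/

section main

variable {H : Type} {h₀ : H} {record : H → ℕ → H}
  {P : DecisionProtocol (floodExchange n t h₀ record)} {F G : Adversary n t}
  {V V' : Fin n → Value} {m : ℕ} {i : Fin n}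

open Adversary

/-- Equal counts give equal records whatever `record` is, so the witness of `Similar` has the same
local state in both runs. -/
theorem CommonKnowledge.of_linked {φ : Formula (floodExchange n t h₀ record)}
    (h : Linked m (F, V) (G, V'))
    (hc : CommonKnowledge (system (floodExchange n t h₀ record) P) φ (runOf h₀ record F V) m) :
    CommonKnowledge (system (floodExchange n t h₀ record) P) φ (runOf h₀ record G V') m := by
  generalize hp : (G, V') = p at h
  induction h generalizing G V' with
  | refl => cases hp; exact hc
  | @tail q p _ hs ih =>
    subst hp
    obtain ⟨i, h1, h2, h3, h4, h5⟩ := hs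
    exact (ih (G := q.1) (V' := q.2) rfl).of_eq (mem_nonfailed_runOf.2 h1) (runOf_mem_system G V')
      ((localState_eq_iff h1).2 ⟨h2, h4, history_congr h5, rfl, h3⟩)

/-- Common knowledge of some initial value, as a condition on the failures. -/
theorem commonKnowledgeOfSomeValue_runOf_iff (ht : t < n)
    (hrec : ∀ h h' c c', record h c = record h' c' → c = c') (hi : F.Alive m i) :
    CommonKnowledgeOfSomeValue (system (floodExchange n t h₀ record) P) (runOf h₀ record F V) m ↔
      min (t + 1) (n - 1) ≤ m ∨ ∃ k < m, n - 1 ≤ F.lost k i := by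
  constructor
  · rintro ⟨v, hv⟩
    by_contra! hc
    obtain ⟨G, hG⟩ := exists_linked_const hc.1 hi hc.2 V (1 - v)
    obtain ⟨j, hj⟩ := G.exists_alive ht m
    have := (hv.of_linked hG).holds (runOf_mem_system G _) (mem_nonfailed_runOf.2 hj)
    obtain ⟨_, h⟩ := someInit_runOf.1 this
    exact one_sub_ne v h
  · rintro (hm | ⟨k, hk, hlost⟩)
    · refine ⟨V i, commonKnowledge_of_invariant
        {p | ∃ F V', p = (runOf h₀ record F V', m) ∧ ∀ j, F.Alive m j → V i ∈ F.seen V' m j}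
        ⟨F, V, rfl, fun j hj => agree_of_le hm i j hi hj (F.init_mem_seen V m i)⟩ ?_ ?_⟩
      · rintro _ _ ⟨G, V', he, h⟩
        cases he
        obtain ⟨j, hj⟩ := G.exists_alive ht m
        exact someInit_runOf.2 (exists_init_of_mem_seen (h j hj))
      · rintro _ _ ⟨G, V', he, h⟩ j hj r hr m' hs
        cases he
        obtain ⟨V₁, hV₁⟩ := exists_eq_runOf hr
        rw [hV₁] at hs ⊢
        rw [mem_nonfailed_runOf] at hj
        obtain ⟨h1, h2, -, rfl, -⟩ := (localState_eq_iff hj).1 hs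
        exact ⟨_, V₁, rfl, fun x hx => agree_of_le hm j x h1 hx (h2 ▸ h j hj)⟩
    · obtain ⟨m, rfl⟩ : ∃ l, m = l + 1 := ⟨m - 1, by omega⟩
      -- By `lost_mono` the loss can be moved to the last round. At points of this set `i` is the
      -- only survivor, and `hrec` recovers the last count from its record, so the set is closed
      -- under what `i` considers possible.
      refine ⟨V i, commonKnowledge_of_invariant
        {p | ∃ F V', p = (runOf h₀ record F V', m + 1) ∧ F.Alive (m + 1) i ∧
          n - 1 ≤ F.lost m i ∧ V' i = V i}
        ⟨F, V, rfl, hi, hlost.trans (lost_mono (by omega)), rfl⟩ ?_ ?_⟩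
      · rintro _ _ ⟨G, V', he, h⟩
        cases he
        exact someInit_runOf.2 ⟨i, h.2.2⟩
      · rintro _ _ ⟨G, V', he, h⟩ j hj r hr m' hs
        cases he
        obtain ⟨V₁, hV₁⟩ := exists_eq_runOf hr
        rw [hV₁] at hs ⊢
        rw [mem_nonfailed_runOf] at hj
        obtain rfl := eq_of_lost h.1 (Nat.lt_succ_self m) h.2.1 hj
        obtain ⟨h1, -, h3, rfl, h5⟩ := (localState_eq_iff hj).1 hs
        exact ⟨_, V₁, rfl, h1, (hrec _ _ _ _ h3) ▸ h.2.1, h5 ▸ h.2.2⟩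

/-- The initial entry `0` occupies index `0`, so index `k + 1` holds the count of round `k + 1`,
which is `F.lost k`. -/
theorem getElem?_history (F : Adversary n t) (i : Fin n) (m k : ℕ) :
    (F.history [0] (fun h c => h ++ [c]) i m)[k + 1]? =
      if k < m then some (F.lost k i) else none := by
  have hlen : ∀ m, (F.history [0] (fun h c => h ++ [c]) i m).length = m + 1 := by
    intro m
    induction m with
    | zero => rfl
    | succ m ih => rw [history, List.length_append, ih, List.length_singleton]
  induction m with
  | zero => simp [history]
  | succ m ih =>
    rw [history, List.getElem?_append, hlen, ih]
    rcases lt_trichotomy k m with h | h | h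
    · simp [h, h.trans (Nat.lt_succ_self m)]
    · simp [h]
    · simp [h.not_gt, show ¬ k < m + 1 by omega, show k - m ≠ 0 by omega]

end main

end FloodSBA

theorem mainTheorem6 (n t : ℕ) (ht : t < n)
    (P : FloodSBA.DecisionProtocol (FloodSBA.countRecallExchange n t))
    (r : FloodSBA.Run (FloodSBA.countRecallExchange n t))
    (hr : r ∈ FloodSBA.system (FloodSBA.countRecallExchange n t) P) (m : ℕ) :
    (∀ (i : Fin n) (W : Set FloodSBA.Value) (h : List ℕ) (τ : ℕ) (v : FloodSBA.Value),
      (r m).2 i = FloodSBA.LocalState.active W h τ v →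
        (FloodSBA.CommonKnowledgeOfSomeValue
            (FloodSBA.system (FloodSBA.countRecallExchange n t) P) r m ↔
          (min (t + 1) (n - 1) ≤ m ∨
            ∃ k c : ℕ, 1 ≤ k ∧ k ≤ m ∧ h[k]? = some c ∧ n - 1 ≤ c))) ∧
    (∀ (P' : FloodSBA.DecisionProtocol (FloodSBA.countExchange n t))
      (r' : FloodSBA.Run (FloodSBA.countExchange n t)),
      r' ∈ FloodSBA.system (FloodSBA.countExchange n t) P' →
        FloodSBA.Corresponding r r' →
          (FloodSBA.CommonKnowledgeOfSomeValue
              (FloodSBA.system (FloodSBA.countRecallExchange n t) P) r m ↔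
            FloodSBA.CommonKnowledgeOfSomeValue
              (FloodSBA.system (FloodSBA.countExchange n t) P') r' m)) := by
  -- Both exchanges are, by definitional unfolding, instances of `floodExchange`.
  obtain ⟨V, hV⟩ := FloodSBA.exists_eq_runOf (H := List ℕ) (h₀ := [0])
    (record := fun h c => h ++ [c]) (P := P) hr
  have hrec : ∀ (h h' : List ℕ) (c c' : ℕ), h ++ [c] = h' ++ [c'] → c = c' := fun h h' c c' he =>
    by simpa using congrArg List.getLast? he
  have key := fun (i : Fin n) (hi : (r 0).1.Alive m i) =>
    FloodSBA.commonKnowledgeOfSomeValue_runOf_iff (H := List ℕ) (h₀ := [0])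
      (record := fun h c => h ++ [c]) (P := P) (V := V) ht hrec hi
  rw [← hV] at key
  refine ⟨fun i W h τ v hs => ?_, fun P' r' hr' hcorr => ?_⟩
  · have hstate := (congrFun (congrArg Prod.snd (congrFun hV m)) i).symm.trans hs
    change (r 0).1.localState [0] (fun h c => h ++ [c]) V m i = _ at hstate
    by_cases hi : (r 0).1.Alive m i
    · simp only [FloodSBA.Adversary.localState, hi, if_true] at hstate
      injection hstate with _ hh _ _
      refine (key i hi).trans (or_congr Iff.rfl ?_)
      rw [← hh]
      constructor
      · rintro ⟨k, hk, hl⟩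
        exact ⟨k + 1, _, by omega, by omega,
          (FloodSBA.getElem?_history _ i m k).trans (if_pos hk), hl⟩
      · rintro ⟨k, c, hk1, hkm, hkc, hl⟩
        obtain ⟨k, rfl⟩ : ∃ l, k = l + 1 := ⟨k - 1, by omega⟩
        rw [FloodSBA.getElem?_history, if_pos (by omega)] at hkc
        cases hkc
        exact ⟨k, by omega, hl⟩
    · simp [FloodSBA.Adversary.localState, hi] at hstate
  · obtain ⟨V', hV'⟩ := FloodSBA.exists_eq_runOf (H := ℕ) (h₀ := 0) (record := fun _ c => c)
      (P := P') hr'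
    -- As `t < n`, some agent survives; at it, both stopping conditions speak of the same adversary.
    obtain ⟨i, hi⟩ := (r 0).1.exists_alive ht m
    have key' := FloodSBA.commonKnowledgeOfSomeValue_runOf_iff (H := ℕ) (h₀ := 0)
      (record := fun _ c => c) (P := P') (V := V') ht (fun _ _ _ _ h => h) (hcorr.1 ▸ hi)
    rw [← hV'] at key'
    refine (key i hi).trans (Iff.trans ?_ key'.symm)
    rw [hcorr.1]
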